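/- **Theorem 1.1.** For a compact Hausdorff space $X$ let $HM(X)$ be the set of all step maps $\alpha:[0,1)\to X$, i.e. maps for which there are $0=t_0\le t_1\le\dots\le t_n=1$ with $\alpha$ constant on each $[t_i,t_{i+1})$. For a continuous $\varphi:X\to\mathbb R$ and $0\le a<b\le 1$ put $$\varphi_{(a,b)}(\alpha)=\frac1{b-a}\int_a^b\varphi(\alpha(t))\,dt,\qquad \alpha\in HM(X).$$ Equip $HM(X)$ with the uniformity generated by the pseudometrics $(\alpha,\beta)\mapsto\max_{1\le i\le n}|g_i(\alpha)-g_i(\beta)|$, where $n\in\mathbb N$ and each $g_i$ is one of the functions $\varphi_{(a,b)}$, and let $HX$ be the completion of this uniform space. For a continuous map $f:X\to Y$ of compact Hausdorff spaces, the map $HM(X)\to HM(Y)$, $\alpha\mapsto f\circ\alpha$, is uniformly continuous; let $Hf:HX\to HY$ be its continuous extension to the completions. Let $f:X\to Y$ be a continuous surjection between compact Hausdorff spaces. Then $Hf$ is an open map if and only if $f$ is an open map. -/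

import Mathlib

namespace HartmanMycielski

open Set MeasureTheory

/-- A map `α : [0,1) → X` is a step map if there is a partition `0 = t₀ ≤ t₁ ≤ ⋯ ≤ tₙ = 1` such that
`α` is constant on each `[tᵢ, tᵢ₊₁)`. -/
def IsStep {X : Type*} (α : Ico (0 : ℝ) 1 → X) : Prop :=
  ∃ (n : ℕ) (t : Fin (n + 1) → ℝ), Monotone t ∧ t 0 = 0 ∧ t (Fin.last n) = 1 ∧
    ∀ (i : Fin n) (s s' : Ico (0 : ℝ) 1),
      (s : ℝ) ∈ Ico (t i.castSucc) (t i.succ) → (s' : ℝ) ∈ Ico (t i.castSucc) (t i.succ) →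
        α s = α s'

/-- `HM X`: the set of all step maps `[0,1) → X`. -/
def HM (X : Type*) : Type _ := {α : Ico (0 : ℝ) 1 → X // IsStep α}

/-- The function `φ_(a,b)` on `HM X`: `φ_(a,b)(α) = (b - a)⁻¹ ∫_a^b φ(α(t)) dt`, where `dt` is
Lebesgue measure on `[0,1)`. -/
noncomputable def HM.avg {X : Type*} [TopologicalSpace X] (φ : C(X, ℝ)) (a b : ℝ) (α : HM X) : ℝ :=
  (b - a)⁻¹ * ∫ t in {t : Ico (0 : ℝ) 1 | (t : ℝ) ∈ Ioo a b},
    φ (α.1 t) ∂(Measure.comap Subtype.val volume)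

/-- The family of all the functions `φ_(a,b)`, with `φ ∈ C(X)` and `0 ≤ a < b ≤ 1`. -/
def SHM (X : Type*) [TopologicalSpace X] : Set (HM X → ℝ) :=
  {g | ∃ (φ : C(X, ℝ)) (a b : ℝ), 0 ≤ a ∧ a < b ∧ b ≤ 1 ∧ g = HM.avg φ a b}

/-- The uniformity on `HM X` given by the pseudometrics `max_i |φ_i(α) - φ_i(β)|` for finitely many
`φ_i` in `SHM X`, that is, the coarsest one making all functions in `SHM X` uniformly continuous. -/
noncomputable instance (X : Type*) [TopologicalSpace X] : UniformSpace (HM X) :=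
  ⨅ g ∈ SHM X, UniformSpace.comap g inferInstance

theorem HM.uniformContinuous_of_mem_SHM {X : Type*} [TopologicalSpace X] {g : HM X → ℝ}
    (hg : g ∈ SHM X) : UniformContinuous g :=
  uniformContinuous_iInf_dom (i := g) (uniformContinuous_iInf_dom (i := hg) uniformContinuous_comap)

/-- `H X` is the (Hausdorff) completion of the uniform space `HM X`. -/
abbrev H (X : Type*) [TopologicalSpace X] : Type _ := UniformSpace.Completion (HM X)

/-- `HM f : HM X → HM Y` is composition with `f`. -/
def HM.map {X Y : Type*} (f : X → Y) (α : HM X) : HM Y :=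
  ⟨f ∘ α.1, by
    obtain ⟨n, t, h1, h2, h3, h4⟩ := α.2
    exact ⟨n, t, h1, h2, h3, fun i s s' hs hs' => congrArg f (h4 i s s' hs hs')⟩⟩

theorem HM.uniformContinuous_map {X Y : Type*} [TopologicalSpace X] [TopologicalSpace Y]
    (f : C(X, Y)) : UniformContinuous (HM.map f : HM X → HM Y) := by
  refine uniformContinuous_iInf_rng.2 fun g => uniformContinuous_iInf_rng.2 fun hg => ?_
  obtain ⟨φ, a, b, ha, hab, hb, rfl⟩ := hg
  refine uniformContinuous_comap' ?_
  exact HM.uniformContinuous_of_mem_SHM ⟨φ.comp f, a, b, ha, hab, hb, rfl⟩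

/-- `H f : H X → H Y` is the continuous extension of `HM f : HM X → HM Y` to the completions. -/
noncomputable def H.map {X Y : Type*} [TopologicalSpace X] [TopologicalSpace Y] (f : C(X, Y)) :
    C(H X, H Y) :=
  ⟨UniformSpace.Completion.map (HM.map f), UniformSpace.Completion.continuous_map⟩

/-- `H f` restricts to `HM f` on `HM X`. -/
theorem H.map_coe {X Y : Type*} [TopologicalSpace X] [TopologicalSpace Y] (f : C(X, Y))
    (α : HM X) : H.map f (α : H X) = (HM.map f α : H Y) :=
  UniformSpace.Completion.map_coe (HM.uniformContinuous_map f) α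

end HartmanMycielski

namespace HartmanMycielski

open Set MeasureTheory Filter Topology Uniformity

/-! For open `f`, the map `HM.map f` is uniformly open: a step map `β` close to `f ∘ α` lifts to
some `α'` close to `α` (`HM.exists_lift_of_isOpenMap`). As `HM X` is totally bounded, compactness of
its completion carries this over to `H.map f` (`isOpenMap_completionMap`).

The lift is a transport of mass. By compactness and openness, `Y` has a partition of unity `κ` so
fine that a point `x` can be moved into the fibre over `y`, almost without changing the test
functions, whenever some `κ l` is positive at both `f x` and `y` (`exists_partition_lift`). Cut
`[0,1)` at the endpoints of the test intervals. Inside one cell only the distribution of values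
matters, so the mass of each set `{β = y}` may be shared freely among the values `x` of `α`: a
fraction `κ l y` follows the law of `α` weighted by `κ l (f x)`. Moving each `x` over its `y` gives
`α'` on that cell (`exists_lift_on_block`).

Conversely, constant step maps embed `Y` continuously in `H Y`. If `H.map f` is open, constants at
points near `f x₀` lift to elements with large average of a bump function at `x₀`; separating such a
point from the image of the bump's large set gives a contradiction. -/

/-! ### Uniform openness and completions -/

/-- A uniformly open map from a totally bounded space extends to an open map of the completions. -/
theorem isOpenMap_completionMap {A B : Type*} [UniformSpace A] [UniformSpace B]
    (hA : TotallyBounded (univ : Set A)) {F : A → B} (hF : UniformContinuous F)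
    (h : ∀ U ∈ 𝓤 A, ∃ V ∈ 𝓤 B, ∀ a b, (F a, b) ∈ V → ∃ a', (a, a') ∈ U ∧ F a' = b) :
    IsOpenMap (UniformSpace.Completion.map F) := by
  have hcpt : CompactSpace (UniformSpace.Completion A) := by
    refine ⟨isCompact_iff_totallyBounded_isComplete.2 ⟨?_, isComplete_univ⟩⟩
    have := (hA.image (UniformSpace.Completion.uniformContinuous_coe A)).closure
    rwa [image_univ, UniformSpace.Completion.denseRange_coe.closure_range] at this
  have hFc : Continuous (UniformSpace.Completion.map F) := UniformSpace.Completion.continuous_map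
  rw [isOpenMap_iff_nhds_le]
  intro ξ O hO
  rw [mem_map, UniformSpace.mem_nhds_iff] at hO
  obtain ⟨U', hU', hUO⟩ := hO
  obtain ⟨U, ⟨hU, hUc⟩, hUU⟩ := uniformity_hasBasis_closed.mem_iff.1 hU'
  obtain ⟨V₀, hV₀, hlift⟩ := h _ (UniformSpace.Completion.uniformContinuous_coe A hU)
  rw [← (UniformSpace.Completion.isUniformInducing_coe B).comap_uniformity, mem_comap] at hV₀
  obtain ⟨V', hV', hVV₀⟩ := hV₀
  obtain ⟨V, ⟨hV, hVo⟩, hVV⟩ := uniformity_hasBasis_open.mem_iff.1 hV'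
  -- `D` is the set of `(ξ, ζ)` such that `ζ` has a preimage `U`-close to `ξ`. It is closed as a
  -- compact image, so it suffices to capture the points of an open set lying in the dense `A × B`.
  set D : Set (UniformSpace.Completion A × UniformSpace.Completion B) :=
    Prod.map id (UniformSpace.Completion.map F) '' U with hD
  have hDc : IsClosed D := (hUc.isCompact.image (continuous_id.prodMap hFc)).isClosed
  have hVD : {p : UniformSpace.Completion A × UniformSpace.Completion B |
      (UniformSpace.Completion.map F p.1, p.2) ∈ V} ⊆ D := by
    have hdense := (UniformSpace.Completion.denseRange_coe (α := A)).prodMap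
      (UniformSpace.Completion.denseRange_coe (α := B))
    refine (Dense.open_subset_closure_inter hdense (hVo.preimage (by fun_prop))).trans ?_
    refine closure_minimal ?_ hDc
    rintro _ ⟨hp, ⟨⟨a, b⟩, rfl⟩⟩
    simp only [Prod.map_apply, mem_preimage, UniformSpace.Completion.map_coe hF] at hp
    obtain ⟨a', haa', rfl⟩ := hlift a b (hVV₀ (hVV hp))
    exact ⟨_, haa', by simp [UniformSpace.Completion.map_coe hF]⟩
  refine mem_of_superset (UniformSpace.ball_mem_nhds _ hV) fun ζ hζ => ?_
  obtain ⟨⟨ξ₁, ξ'⟩, hξ, heq⟩ := hVD (show (ξ, ζ) ∈ {p | _} from hζ)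
  simp only [Prod.map_apply, id, Prod.mk.injEq] at heq
  obtain ⟨rfl, rfl⟩ := heq
  exact hUO (hUU hξ)

/-! ### The uniformity of `HM X`, Lebesgue measure and total boundedness -/

theorem HM.uniformity_eq (X : Type*) [TopologicalSpace X] :
    𝓤 (HM X) = ⨅ g : SHM X, comap (fun p : HM X × HM X => (g.1 p.1, g.1 p.2)) (𝓤 ℝ) := by
  refine (iInf_uniformity (ι := HM X → ℝ)).trans ?_
  simp only [iInf_uniformity, uniformity_comap, iInf_subtype]
  rfl

/-- Every entourage contains one given by finitely many test functions. -/
theorem HM.exists_finset_of_mem_uniformity {X : Type*} [TopologicalSpace X] {U : Set (HM X × HM X)}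
    (hU : U ∈ 𝓤 (HM X)) : ∃ (s : Finset (SHM X)) (ε : ℝ), 0 < ε ∧
      ∀ α β : HM X, (∀ g ∈ s, |g.1 α - g.1 β| < ε) → (α, β) ∈ U := by
  rw [HM.uniformity_eq] at hU
  obtain ⟨⟨I, δ⟩, ⟨hI, hδ⟩, hsub⟩ := (HasBasis.iInf' fun g : SHM X =>
    (Metric.uniformity_basis_dist).comap
      (fun p : HM X × HM X => (g.1 p.1, g.1 p.2))).mem_iff.1 hU
  have : ∀ᶠ ε in 𝓝[>] (0 : ℝ), ∀ g ∈ I, ε < δ g :=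
    (eventually_all_finite hI).2 fun g hg => mem_of_superset (Ioo_mem_nhdsGT (hδ g hg)) fun x hx => hx.2
  obtain ⟨ε, hε, hε0⟩ := (this.and self_mem_nhdsWithin).exists
  refine ⟨hI.toFinset, ε, hε0, fun α β h => hsub ?_⟩
  simp only [mem_iInter]
  exact fun g hg => (h g (hI.mem_toFinset.2 hg)).trans (hε g hg)

/-- Lebesgue measure on `[0,1)`. -/
noncomputable abbrev lebesgue : Measure (Ico (0 : ℝ) 1) := Measure.comap Subtype.val volume

theorem lebesgue_preimage (s : Set ℝ) :
    lebesgue (Subtype.val ⁻¹' s) = volume (Ico 0 1 ∩ s) := by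
  rw [comap_subtype_coe_apply measurableSet_Ico, Subtype.image_preimage_coe]

instance : IsProbabilityMeasure lebesgue :=
  ⟨by rw [← preimage_univ, lebesgue_preimage]; simp⟩

instance : NullSingletonClass lebesgue :=
  ⟨fun x => by rw [comap_subtype_coe_apply measurableSet_Ico]; simp⟩

theorem lebesgue_real_Ico {a b : ℝ} (ha : 0 ≤ a) (hab : a ≤ b) (hb : b ≤ 1) :
    lebesgue.real {t | (t : ℝ) ∈ Ico a b} = b - a := by
  have : lebesgue {t | (t : ℝ) ∈ Ico a b} = _ := lebesgue_preimage (Ico a b)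
  rw [Measure.real, this, inter_eq_right.2 (Ico_subset_Ico ha hb)]
  simp [hab]

theorem lebesgue_real_Ico_le (a b : ℝ) (hab : a ≤ b) :
    lebesgue.real {t | (t : ℝ) ∈ Ico a b} ≤ b - a := by
  have : lebesgue {t | (t : ℝ) ∈ Ico a b} = _ := lebesgue_preimage (Ico a b)
  rw [Measure.real, this]
  refine (measureReal_mono inter_subset_right (by simp)).trans_eq (Real.volume_real_Ico_of_le hab)

theorem measurableSet_val_Ico (a b : ℝ) :
    MeasurableSet {t : Ico (0 : ℝ) 1 | (t : ℝ) ∈ Ico a b} :=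
  measurable_subtype_coe measurableSet_Ico

/-- Half-open intervals are unions of cells, so averages can be split exactly over a partition. -/
theorem setIntegral_Ioo_eq_Ico (a b : ℝ) (g : Ico (0 : ℝ) 1 → ℝ) :
    ∫ t in {t | (t : ℝ) ∈ Ioo a b}, g t ∂lebesgue =
      ∫ t in {t | (t : ℝ) ∈ Ico a b}, g t ∂lebesgue := by
  refine setIntegral_congr_set ?_
  have : (Subtype.val ⁻¹' {a} : Set (Ico (0 : ℝ) 1)).Subsingleton :=
    subsingleton_singleton.preimage Subtype.val_injective
  filter_upwards [compl_mem_ae_iff.2 (this.measure_zero lebesgue)] with t ht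
  refine propext ⟨fun h => Ioo_subset_Ico_self h, fun h => ⟨lt_of_le_of_ne h.1 ?_, h.2⟩⟩
  exact fun h' => ht h'.symm

theorem HM.avg_eq {X : Type*} [TopologicalSpace X] (φ : C(X, ℝ)) (a b : ℝ) (α : HM X) :
    HM.avg φ a b α =
      (b - a)⁻¹ * ∫ t in {t | (t : ℝ) ∈ Ico a b}, φ (α.1 t) ∂lebesgue := by
  rw [HM.avg, setIntegral_Ioo_eq_Ico]

theorem HM.abs_avg_le {X : Type*} [TopologicalSpace X] (φ : C(X, ℝ)) {M : ℝ}
    (hM : ∀ x, |φ x| ≤ M) {a b : ℝ} (ha : 0 ≤ a) (hab : a < b) (hb : b ≤ 1) (α : HM X) :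
    |HM.avg φ a b α| ≤ M := by
  have h := norm_setIntegral_le_of_norm_le_const (μ := lebesgue)
    (s := {t | (t : ℝ) ∈ Ico a b}) (f := fun t => φ (α.1 t)) (measure_lt_top _ _)
    fun t _ => hM _
  rw [lebesgue_real_Ico ha hab.le hb, Real.norm_eq_abs] at h
  rw [HM.avg_eq, abs_mul, abs_inv, abs_of_pos (sub_pos.2 hab), inv_mul_le_iff₀ (sub_pos.2 hab)]
  linarith

/-- The test functions induce the uniformity from a product of lines, and each is bounded, so the
image lies in a compact product of intervals. -/
theorem HM.totallyBounded_univ (X : Type*) [TopologicalSpace X] [CompactSpace X] :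
    TotallyBounded (univ : Set (HM X)) := by
  have hind : IsUniformInducing fun (α : HM X) (g : SHM X) => g.1 α := by
    refine ⟨?_⟩
    rw [Pi.uniformity, comap_iInf, HM.uniformity_eq]
    simp only [comap_comap, Function.comp_def]
  have hbd : ∀ g : SHM X, ∃ M : ℝ, ∀ α, |g.1 α| ≤ M := by
    rintro ⟨_, φ, a, b, ha, hab, hb, rfl⟩
    exact ⟨‖φ‖, HM.abs_avg_le φ (fun x => φ.norm_coe_le_norm x) ha hab hb⟩
  choose M hM using hbd
  have hK : TotallyBounded (univ.pi fun g : SHM X => Icc (-M g) (M g)) :=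
    (isCompact_univ_pi fun g => isCompact_Icc).totallyBounded
  refine (totallyBounded_preimage hind hK).subset fun α _ => ?_
  exact fun g _ => abs_le.1 (hM g α)

/-! ### Cells and the calculus of step maps -/

/-- The points of the finite set `F` to the left of `t`; as a function of `t` it records the cell of
the partition of `[0,1)` cut out by `F`. -/
noncomputable def cell (F : Finset ℝ) (t : Ico (0 : ℝ) 1) : Finset ℝ := F.filter (· ≤ (t : ℝ))

theorem mem_cell {F : Finset ℝ} {t : Ico (0 : ℝ) 1} {c : ℝ} : c ∈ cell F t ↔ c ∈ F ∧ c ≤ t := by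
  simp [cell]

theorem cell_eq_cell_iff {F : Finset ℝ} {s t : Ico (0 : ℝ) 1} :
    cell F s = cell F t ↔ ∀ c ∈ F, c ≤ (s : ℝ) ↔ c ≤ t := by
  simp only [Finset.ext_iff, mem_cell]
  exact forall_congr' fun c => by tauto

theorem cell_eq_cell_of_subset {F G : Finset ℝ} (h : F ⊆ G) {s t : Ico (0 : ℝ) 1}
    (hst : cell G s = cell G t) : cell F s = cell F t :=
  cell_eq_cell_iff.2 fun c hc => cell_eq_cell_iff.1 hst c (h hc)

theorem measurableSet_cell (F S : Finset ℝ) : MeasurableSet {t | cell F t = S} := by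
  by_cases hS : ∃ s, cell F s = S
  · obtain ⟨s, rfl⟩ := hS
    simp only [cell_eq_cell_iff, ofPred_forall]
    refine F.measurableSet_biInter fun c _ => ?_
    by_cases hc : c ≤ (s : ℝ)
    · simp only [hc, iff_true]
      exact measurableSet_le measurable_const measurable_subtype_coe
    · simp only [hc, iff_false, not_le]
      exact measurableSet_lt measurable_subtype_coe measurable_const
  · convert! MeasurableSet.empty
    exact eq_empty_of_forall_notMem fun t ht => hS ⟨t, ht⟩

/-- A function is a step map iff it is constant on the cells of a finite set. -/
theorem isStep_iff {X : Type*} {α : Ico (0 : ℝ) 1 → X} :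
    IsStep α ↔ ∃ F : Finset ℝ, ∀ s t, cell F s = cell F t → α s = α t := by
  classical
  constructor
  · rintro ⟨n, t, -, h0, h1, hα⟩
    refine ⟨Finset.univ.image t, fun s s' hss => ?_⟩
    have hle : ∀ i, t i ≤ s ↔ t i ≤ s' := fun i => cell_eq_cell_iff.1 hss _ (by simp)
    -- Taking the largest index with `t i ≤ s` handles repeated partition points.
    set A := Finset.univ.filter fun i => t i ≤ (s : ℝ)
    have hA : A.Nonempty := ⟨0, by simp [A, h0, s.2.1]⟩
    have hmem : t (A.max' hA) ≤ s := (Finset.mem_filter.1 (A.max'_mem hA)).2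
    obtain ⟨j, hj⟩ | hlast := (A.max' hA).eq_castSucc_or_eq_last
    · have hsucc : ¬ t j.succ ≤ s := fun h => by
        have := A.le_max' j.succ (by simp [A, h])
        rw [hj] at this
        exact absurd this (not_le.2 j.castSucc_lt_succ)
      rw [hj] at hmem
      exact hα j s s' ⟨hmem, not_le.1 hsucc⟩
        ⟨(hle _).1 hmem, not_le.1 fun h => hsucc ((hle _).2 h)⟩
    · rw [hlast, h1] at hmem
      exact absurd s.2.2 (not_lt.2 hmem)
  · rintro ⟨F, hF⟩
    set G := insert 0 (insert 1 (F.filter fun c => c ∈ Icc (0 : ℝ) 1)) with hG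
    have hG01 : ∀ c ∈ G, 0 ≤ c ∧ c ≤ 1 := by
      intro c hc
      simp only [hG, Finset.mem_insert, Finset.mem_filter, mem_Icc] at hc
      rcases hc with rfl | rfl | h
      · simp
      · simp
      · exact h.2
    obtain ⟨n, hn⟩ : ∃ n, G.card = n + 1 :=
      Nat.exists_eq_succ_of_ne_zero (Finset.card_ne_zero_of_mem (by simp [hG] : (0 : ℝ) ∈ G))
    have hex : ∀ c ∈ G, ∃ k, G.orderEmbOfFin hn k = c := fun c hc => by
      have : c ∈ range (G.orderEmbOfFin hn) := by rwa [Finset.range_orderEmbOfFin]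
      exact this
    have hmono := (G.orderEmbOfFin hn).monotone
    refine ⟨n, G.orderEmbOfFin hn, hmono, ?_, ?_, ?_⟩
    · obtain ⟨k, hk⟩ := hex 0 (by simp [hG])
      exact le_antisymm (hk ▸ hmono (Fin.zero_le k)) (hG01 _ (Finset.orderEmbOfFin_mem _ _ _)).1
    · obtain ⟨k, hk⟩ := hex 1 (by simp [hG])
      exact le_antisymm (hG01 _ (Finset.orderEmbOfFin_mem _ _ _)).2 (hk ▸ hmono (Fin.le_last k))
    · have key : ∀ (i : Fin n) (s s' : Ico (0 : ℝ) 1),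
          (s : ℝ) ∈ Ico (G.orderEmbOfFin hn i.castSucc) (G.orderEmbOfFin hn i.succ) →
          (s' : ℝ) ∈ Ico (G.orderEmbOfFin hn i.castSucc) (G.orderEmbOfFin hn i.succ) →
          ∀ c ∈ F, c ≤ s → c ≤ s' := by
        intro i s s' hs hs' c hc hcs
        rcases le_total c 0 with h0 | h0
        · exact h0.trans s'.2.1
        · obtain ⟨k, rfl⟩ := hex c (by simp [hG, hc, h0, hcs.trans s.2.2.le])
          have hk : k < i.succ := (G.orderEmbOfFin hn).lt_iff_lt.1 (hcs.trans_lt hs.2)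
          exact (hmono (Fin.le_castSucc_iff.2 hk)).trans hs'.1
      exact fun i s s' hs hs' =>
        hF _ _ (cell_eq_cell_iff.2 fun c hc => ⟨key i s s' hs hs' c hc, key i s' s hs' hs c hc⟩)

theorem IsStep.const {X : Type*} (x : X) : IsStep fun _ => x :=
  isStep_iff.2 ⟨∅, fun _ _ _ => rfl⟩

theorem isStep_cell (F : Finset ℝ) : IsStep (cell F) := isStep_iff.2 ⟨F, fun _ _ h => h⟩

theorem IsStep.prodMk {X Y : Type*} {α : Ico (0 : ℝ) 1 → X} {β : Ico (0 : ℝ) 1 → Y}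
    (hα : IsStep α) (hβ : IsStep β) : IsStep fun t => (α t, β t) := by
  classical
  obtain ⟨F, hF⟩ := isStep_iff.1 hα
  obtain ⟨G, hG⟩ := isStep_iff.1 hβ
  refine isStep_iff.2 ⟨F ∪ G, fun s t h => ?_⟩
  rw [hF s t (cell_eq_cell_of_subset Finset.subset_union_left h),
    hG s t (cell_eq_cell_of_subset Finset.subset_union_right h)]

theorem IsStep.comp {X Y : Type*} {α : Ico (0 : ℝ) 1 → X} (hα : IsStep α) (g : X → Y) :
    IsStep fun t => g (α t) := by
  obtain ⟨F, hF⟩ := isStep_iff.1 hα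
  exact isStep_iff.2 ⟨F, fun s t h => congrArg g (hF s t h)⟩

theorem IsStep.finite_range {X : Type*} {α : Ico (0 : ℝ) 1 → X} (hα : IsStep α) :
    (range α).Finite := by
  obtain ⟨F, hF⟩ := isStep_iff.1 hα
  have hcell : (range (cell F)).Finite :=
    (F.powerset.finite_toSet).subset (by
      rintro _ ⟨t, rfl⟩
      exact Finset.mem_coe.2 (Finset.mem_powerset.2 fun c hc => (mem_cell.1 hc).1))
  have : range α = (fun S => α (Function.invFun (cell F) S)) '' range (cell F) := by
    rw [← range_comp]
    congr 1
    ext t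
    exact hF _ _ (Function.invFun_eq ⟨t, rfl⟩).symm
  rw [this]
  exact hcell.image _

/-- Step maps glued along a step map form a step map. -/
theorem IsStep.bind {X Y : Type*} {β : Ico (0 : ℝ) 1 → Y} (hβ : IsStep β)
    {γ : Y → Ico (0 : ℝ) 1 → X} (hγ : ∀ y, IsStep (γ y)) : IsStep fun t => γ (β t) t := by
  classical
  obtain ⟨F, hF⟩ := isStep_iff.1 hβ
  choose G hG using fun y => isStep_iff.1 (hγ y)
  refine isStep_iff.2 ⟨F ∪ hβ.finite_range.toFinset.biUnion G, fun s t h => ?_⟩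
  have hst := hF s t (cell_eq_cell_of_subset Finset.subset_union_left h)
  simp only [hst]
  refine hG _ _ _ (cell_eq_cell_of_subset (subset_trans ?_ Finset.subset_union_right) h)
  exact Finset.subset_biUnion_of_mem G (by simp)

theorem IsStep.measurableSet_preimage {X : Type*} {α : Ico (0 : ℝ) 1 → X} (hα : IsStep α)
    (A : Set X) : MeasurableSet (α ⁻¹' A) := by
  classical
  obtain ⟨F, hF⟩ := isStep_iff.1 hα
  have : α ⁻¹' A = ⋃ S ∈ (isStep_cell F).finite_range.toFinset.filter
      (fun S => ∃ t, cell F t = S ∧ α t ∈ A), {t | cell F t = S} := by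
    ext t
    simp only [mem_preimage, Finset.mem_filter, mem_iUnion, Finite.mem_toFinset, mem_ofPred_eq,
      exists_prop]
    constructor
    · exact fun h => ⟨cell F t, ⟨mem_range_self t, t, rfl, h⟩, rfl⟩
    · rintro ⟨_, ⟨-, s, hs, h⟩, rfl⟩
      rwa [← hF _ _ hs]
  rw [this]
  exact Finset.measurableSet_biUnion _ fun S _ => measurableSet_cell F S

theorem IsStep.integrable {g : Ico (0 : ℝ) 1 → ℝ} (hg : IsStep g) : Integrable g lebesgue := by
  have hm : Measurable g := fun A _ => hg.measurableSet_preimage A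
  obtain ⟨C, hC⟩ := (hg.finite_range.image norm).bddAbove
  exact Integrable.of_bound hm.aestronglyMeasurable C
    (Eventually.of_forall fun t => hC ⟨_, mem_range_self t, rfl⟩)

/-- Splitting an integral along the level sets of a step map. -/
theorem IsStep.setIntegral_eq_sum {X : Type*} {α : Ico (0 : ℝ) 1 → X} (hα : IsStep α)
    {R : Finset X} (hR : ∀ t, α t ∈ R) {B : Set (Ico (0 : ℝ) 1)} (hB : MeasurableSet B)
    {g : Ico (0 : ℝ) 1 → ℝ} (hg : IsStep g) :
    ∫ t in B, g t ∂lebesgue = ∑ x ∈ R, ∫ t in B ∩ α ⁻¹' {x}, g t ∂lebesgue := by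
  rw [← integral_biUnion_finset]
  · congr 2
    ext t
    simp [hR]
  · exact fun x _ => hB.inter (hα.measurableSet_preimage _)
  · exact fun x _ y _ hxy => disjoint_left.2 fun t ht ht' => hxy (ht.2.symm.trans ht'.2)
  · exact fun x _ => hg.integrable.integrableOn

theorem IsStep.setIntegral_comp {X : Type*} {α : Ico (0 : ℝ) 1 → X} (hα : IsStep α)
    {R : Finset X} (hR : ∀ t, α t ∈ R) {B : Set (Ico (0 : ℝ) 1)} (hB : MeasurableSet B)
    (h : X → ℝ) :
    ∫ t in B, h (α t) ∂lebesgue = ∑ x ∈ R, lebesgue.real (B ∩ α ⁻¹' {x}) * h x := by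
  rw [hα.setIntegral_eq_sum hR hB (hα.comp h)]
  refine Finset.sum_congr rfl fun x _ => ?_
  rw [setIntegral_congr_fun (g := fun _ => h x) (hB.inter (hα.measurableSet_preimage {x}))
    (fun t ht => congrArg h (mem_singleton_iff.1 ht.2)), setIntegral_const, smul_eq_mul]

/-! ### Realising prescribed distributions -/

/-- The non-atomic measure space `[0,1)` splits by cut points. -/
theorem exists_cut {B : Set (Ico (0 : ℝ) 1)} {w : ℝ} (hw : 0 ≤ w)
    (hwB : w ≤ lebesgue.real B) : ∃ c : ℝ, lebesgue.real (B ∩ {t | (t : ℝ) < c}) = w := by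
  have hmono : ∀ c d : ℝ, c ≤ d → lebesgue.real (B ∩ {t | (t : ℝ) < c}) ≤
      lebesgue.real (B ∩ {t | (t : ℝ) < d}) := fun c d hcd =>
    measureReal_mono (inter_subset_inter_right _ fun t (ht : (t : ℝ) < c) => ht.trans_le hcd)
  -- The mass to the left of `c` is 1-Lipschitz in `c`, so the intermediate value theorem applies.
  have hlip : ∀ c d : ℝ, c ≤ d → lebesgue.real (B ∩ {t | (t : ℝ) < d}) ≤
      lebesgue.real (B ∩ {t | (t : ℝ) < c}) + (d - c) := fun c d hcd => by
    refine (measureReal_mono (s₂ := (B ∩ {t | (t : ℝ) < c}) ∪ {t | (t : ℝ) ∈ Ico c d}) ?_).trans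
      ((measureReal_union_le _ _).trans (add_le_add_right (lebesgue_real_Ico_le c d hcd) _))
    rintro t ⟨htB, ht⟩
    rcases lt_or_ge (t : ℝ) c with h | h
    · exact Or.inl ⟨htB, h⟩
    · exact Or.inr ⟨h, ht⟩
  have hcont : Continuous fun c : ℝ => lebesgue.real (B ∩ {t | (t : ℝ) < c}) := by
    refine (LipschitzWith.of_le_add fun c d => ?_).continuous
    rcases le_total c d with h | h
    · exact (hmono c d h).trans (by linarith [dist_nonneg (x := c) (y := d)])
    · refine (hlip d c h).trans ?_
      rw [Real.dist_eq, abs_of_nonneg (sub_nonneg.2 h)]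
  have h0 : lebesgue.real (B ∩ {t | (t : ℝ) < 0}) = 0 := by
    rw [show B ∩ {t : Ico (0 : ℝ) 1 | (t : ℝ) < 0} = ∅ from ?_, measureReal_empty]
    exact eq_empty_of_forall_notMem fun t ht => absurd t.2.1 (not_le.2 ht.2)
  have h1 : lebesgue.real (B ∩ {t | (t : ℝ) < 1}) = lebesgue.real B := by
    congr 1
    exact inter_eq_left.2 fun t _ => t.2.2
  obtain ⟨c, -, hc⟩ := intermediate_value_Icc zero_le_one hcont.continuousOn
    (show w ∈ Icc _ _ by rw [h0, h1]; exact ⟨hw, hwB⟩)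
  exact ⟨c, hc⟩

/-- Every finite distribution of the mass of `B` is realised by a step map. -/
theorem exists_isStep_distribution {X : Type*} [Nonempty X] (R : Finset X) (w : X → ℝ)
    (hw : ∀ x ∈ R, 0 ≤ w x) {B : Set (Ico (0 : ℝ) 1)} (hB : MeasurableSet B)
    (hsum : ∑ x ∈ R, w x = lebesgue.real B) :
    ∃ ρ : Ico (0 : ℝ) 1 → X, IsStep ρ ∧
      ∀ h : X → ℝ, ∫ t in B, h (ρ t) ∂lebesgue = ∑ x ∈ R, w x * h x := by
  classical
  induction R using Finset.induction_on generalizing B with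
  | empty =>
    refine ⟨fun _ => Classical.arbitrary X, IsStep.const _, fun h => ?_⟩
    rw [setIntegral_const, ← hsum]
    simp
  | insert x R hx ih =>
    rw [Finset.sum_insert hx] at hsum
    have hwR : ∀ y ∈ R, 0 ≤ w y := fun y hy => hw y (Finset.mem_insert_of_mem hy)
    -- The value `x` takes the part of `B` left of `c`; the remaining values share the rest.
    obtain ⟨c, hc⟩ := exists_cut (hw x (Finset.mem_insert_self _ _))
      (by rw [← hsum]; exact le_add_of_nonneg_right (Finset.sum_nonneg hwR))
    have hm : MeasurableSet {t : Ico (0 : ℝ) 1 | (t : ℝ) < c} :=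
      measurableSet_lt measurable_subtype_coe measurable_const
    have hsplit := measureReal_inter_add_sdiff (μ := lebesgue) (s := B) hm
    obtain ⟨ρ, hρ, hint⟩ := ih hwR (hB.diff hm) (by linarith)
    have hstep : IsStep fun t : Ico (0 : ℝ) 1 => if (t : ℝ) < c then x else ρ t := by
      obtain ⟨F, hF⟩ := isStep_iff.1 hρ
      refine isStep_iff.2 ⟨insert c F, fun s t hst => ?_⟩
      have h := cell_eq_cell_iff.1 hst c (Finset.mem_insert_self _ _)
      have := hF s t (cell_eq_cell_of_subset (Finset.subset_insert _ _) hst)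
      by_cases hs : c ≤ (s : ℝ)
      · simp [not_lt.2 hs, not_lt.2 (h.1 hs), this]
      · simp [not_le.1 hs, not_le.1 fun h' => hs (h.2 h')]
    refine ⟨_, hstep, fun h => ?_⟩
    rw [Finset.sum_insert hx, ← hint, ← integral_inter_add_sdiff hm
      ((hstep.comp h).integrable.integrableOn)]
    congr 1
    · rw [setIntegral_congr_fun (g := fun _ => h x) (hB.inter hm), setIntegral_const, hc,
        smul_eq_mul]
      intro t ht
      simp only [if_pos (show (t : ℝ) < c from ht.2)]
    · refine setIntegral_congr_fun (hB.diff hm) fun t ht => ?_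
      simp only [if_neg (show ¬ (t : ℝ) < c from ht.2)]

/-! ### Transport of mass on one block -/

/-- Replacing the mass `p` distributed by `r` with the mass `q` distributed by `b v ⊗ r` changes
averages little. -/
theorem abs_sum_sub_sum_le {X Y : Type*} (R : Finset X) (Q : Finset Y) {r u a : X → ℝ} {v : Y → ℝ}
    {p q ε M : ℝ} {φ : X → ℝ} {ψ : X → Y → ℝ} (hr : ∀ x ∈ R, 0 ≤ r x) (hr1 : ∑ x ∈ R, r x = 1)
    (hrp : ∀ x ∈ R, r x * p = a x * u x) (hv : ∀ y ∈ Q, 0 ≤ v y) (hq : ∑ y ∈ Q, v y = q)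
    (hu : ∀ x ∈ R, 0 ≤ u x) (hε : 0 ≤ ε) (hφ : ∀ x, |φ x| ≤ M) (hψ : ∀ x y, |ψ x y| ≤ M)
    (hclose : ∀ x ∈ R, ∀ y ∈ Q, 0 < u x → 0 < v y → |ψ x y - φ x| ≤ ε) :
    |∑ y ∈ Q, v y * ∑ x ∈ R, r x * ψ x y - ∑ x ∈ R, a x * u x * φ x| ≤
      ε * q + 3 * M * |q - p| := by
  have hq0 : 0 ≤ q := hq ▸ Finset.sum_nonneg hv
  have hM : |∑ x ∈ R, r x * φ x| ≤ M := by
    refine (Finset.abs_sum_le_sum_abs _ _).trans ?_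
    calc ∑ x ∈ R, |r x * φ x| ≤ ∑ x ∈ R, r x * M := Finset.sum_le_sum fun x hx => by
          rw [abs_mul, abs_of_nonneg (hr x hx)]
          exact mul_le_mul_of_nonneg_left (hφ x) (hr x hx)
      _ = M := by rw [← Finset.sum_mul, hr1, one_mul]
  have hM0 : 0 ≤ M := (abs_nonneg _).trans hM
  -- If `p = 0`, the weights `r` carry no information about `u` and only the trivial bound `2 * M`
  -- is left. Then `q = |q - p|`, so this loss joins the error `M * |q - p|` below; hence the
  -- constant 3.
  have hterm : ∀ y ∈ Q, ∀ x ∈ R, |v y * (r x * (ψ x y - φ x))| ≤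
      v y * (r x * (ε + if p = 0 then 2 * M else 0)) := by
    intro y hy x hx
    rw [abs_mul, abs_mul, abs_of_nonneg (hr x hx), abs_of_nonneg (hv y hy)]
    rcases (hr x hx).eq_or_lt with hr0 | hr0
    · simp [← hr0]
    rcases (hv y hy).eq_or_lt with hv0 | hv0
    · simp [← hv0]
    refine mul_le_mul_of_nonneg_left (mul_le_mul_of_nonneg_left ?_ hr0.le) hv0.le
    split_ifs with hp
    · have := abs_sub (ψ x y) (φ x)
      linarith [hφ x, hψ x y]
    · rw [add_zero]
      refine hclose x hx y hy ((hu x hx).lt_of_ne fun h => ?_) hv0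
      have := hrp x hx
      rw [← h, mul_zero] at this
      exact (mul_ne_zero hr0.ne' hp) this
  have heq : ∑ y ∈ Q, v y * ∑ x ∈ R, r x * ψ x y - ∑ x ∈ R, a x * u x * φ x =
      (∑ y ∈ Q, ∑ x ∈ R, v y * (r x * (ψ x y - φ x))) + (q - p) * ∑ x ∈ R, r x * φ x := by
    have h1 : ∑ x ∈ R, a x * u x * φ x = p * ∑ x ∈ R, r x * φ x := by
      rw [Finset.mul_sum]
      exact Finset.sum_congr rfl fun x hx => by rw [← hrp x hx]; ring
    have h2 : ∑ y ∈ Q, ∑ x ∈ R, v y * (r x * (ψ x y - φ x)) =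
        ∑ y ∈ Q, v y * ∑ x ∈ R, r x * ψ x y - q * ∑ x ∈ R, r x * φ x := by
      rw [← hq, Finset.sum_mul, ← Finset.sum_sub_distrib]
      refine Finset.sum_congr rfl fun y _ => ?_
      rw [← Finset.mul_sum, ← mul_sub, ← Finset.sum_sub_distrib]
      simp only [mul_sub]
    rw [h1, h2]; ring
  have hfirst : |∑ y ∈ Q, ∑ x ∈ R, v y * (r x * (ψ x y - φ x))| ≤
      q * (ε + if p = 0 then 2 * M else 0) := by
    refine (Finset.abs_sum_le_sum_abs _ _).trans ?_
    rw [← hq, Finset.sum_mul]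
    refine Finset.sum_le_sum fun y hy => (Finset.abs_sum_le_sum_abs _ _).trans ?_
    refine (Finset.sum_le_sum (hterm y hy)).trans_eq ?_
    rw [← Finset.mul_sum, ← Finset.sum_mul, hr1, one_mul]
  rw [heq]
  refine (abs_add_le _ _).trans ?_
  have hsecond : |(q - p) * ∑ x ∈ R, r x * φ x| ≤ |q - p| * M := by
    rw [abs_mul]
    exact mul_le_mul_of_nonneg_left hM (abs_nonneg _)
  split_ifs at hfirst with hp
  · rw [hp, sub_zero, abs_of_nonneg hq0] at hsecond ⊢
    linarith
  · nlinarith [mul_nonneg hM0 (abs_nonneg (q - p))]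

/-- A normalised version of a finite family of weights. -/
theorem exists_normalization {X : Type*} {R : Finset X} (hR : R.Nonempty) {w : X → ℝ}
    (hw : ∀ x ∈ R, 0 ≤ w x) : ∃ r : X → ℝ, (∀ x ∈ R, 0 ≤ r x) ∧ ∑ x ∈ R, r x = 1 ∧
      ∀ x ∈ R, r x * ∑ x ∈ R, w x = w x := by
  classical
  by_cases hp : ∑ x ∈ R, w x = 0
  · obtain ⟨x₀, hx₀⟩ := hR
    refine ⟨fun x => if x = x₀ then 1 else 0, fun x _ => ?_, by simp [hx₀], fun x hx => ?_⟩
    · dsimp only; split_ifs <;> norm_num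
    · rw [hp, mul_zero, (Finset.sum_eq_zero_iff_of_nonneg hw).1 hp x hx]
  · refine ⟨fun x => w x / ∑ x ∈ R, w x,
      fun x hx => div_nonneg (hw x hx) (Finset.sum_nonneg hw), ?_, fun x _ => div_mul_cancel₀ _ hp⟩
    rw [← Finset.sum_div, div_self hp]

/-- On a measurable block `B`, a step map over `β` is found whose averages are close to those of
`α`, provided that `f ∘ α` and `β` have close averages on `B`. -/
theorem exists_lift_on_block {X Y L : Type*} [Fintype L] {f : X → Y} {κ : L → Y → ℝ}
    (hκ : ∀ l y, 0 ≤ κ l y) (hκ1 : ∀ y, ∑ l, κ l y = 1) (lift : X → Y → X)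
    {α : Ico (0 : ℝ) 1 → X} {β : Ico (0 : ℝ) 1 → Y} (hα : IsStep α) (hβ : IsStep β)
    {B : Set (Ico (0 : ℝ) 1)} (hB : MeasurableSet B) :
    ∃ ρ : Y → Ico (0 : ℝ) 1 → X, (∀ y, IsStep (ρ y)) ∧
      ∀ (φ : X → ℝ) (M ε : ℝ), (∀ x, |φ x| ≤ M) → 0 ≤ ε →
        (∀ x y l, 0 < κ l (f x) → 0 < κ l y → |φ (lift x y) - φ x| ≤ ε) →
        |∫ t in B, φ (lift (ρ (β t) t) (β t)) ∂lebesgue - ∫ t in B, φ (α t) ∂lebesgue| ≤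
          ε * lebesgue.real B + 3 * M * ∑ l, |∫ t in B, κ l (β t) ∂lebesgue -
            ∫ t in B, κ l (f (α t)) ∂lebesgue| := by
  obtain ⟨R, hR⟩ : ∃ R : Finset X, ∀ t, α t ∈ R :=
    ⟨hα.finite_range.toFinset, fun t => by simp⟩
  obtain ⟨Q, hQ⟩ : ∃ Q : Finset Y, ∀ t, β t ∈ Q :=
    ⟨hβ.finite_range.toFinset, fun t => by simp⟩
  have hRne : R.Nonempty := ⟨_, hR ⟨0, by simp⟩⟩
  have : Nonempty X := hRne.to_type
  set a : X → ℝ := fun x => lebesgue.real (B ∩ α ⁻¹' {x})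
  set b : Y → ℝ := fun y => lebesgue.real (B ∩ β ⁻¹' {y})
  have ha : ∀ x, 0 ≤ a x := fun x => measureReal_nonneg
  have hb : ∀ x, 0 ≤ b x := fun x => measureReal_nonneg
  have hαint : ∀ h : X → ℝ, ∫ t in B, h (α t) ∂lebesgue = ∑ x ∈ R, a x * h x :=
    hα.setIntegral_comp hR hB
  have hβint : ∀ h : Y → ℝ, ∫ t in B, h (β t) ∂lebesgue = ∑ y ∈ Q, b y * h y :=
    hβ.setIntegral_comp hQ hB
  -- `r l` is the law of `α` on `B` reweighted by `κ l ∘ f`, and arbitrary if that weight vanishes.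
  choose r hr hr1 hrp using fun l => exists_normalization hRne (w := fun x => a x * κ l (f x))
    fun x _ => mul_nonneg (ha x) (hκ l _)
  have hρ : ∀ y, ∃ ρ : Ico (0 : ℝ) 1 → X, IsStep ρ ∧ ∀ h : X → ℝ,
      ∫ t in B ∩ β ⁻¹' {y}, h (ρ t) ∂lebesgue = ∑ x ∈ R, (b y * ∑ l, κ l y * r l x) * h x := by
    refine fun y => exists_isStep_distribution R _ (fun x hx => mul_nonneg (hb y)
      (Finset.sum_nonneg fun l _ => mul_nonneg (hκ l y) (hr l x hx)))
      (hB.inter (hβ.measurableSet_preimage _)) ?_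
    rw [← Finset.mul_sum, Finset.sum_comm]
    simp only [← Finset.mul_sum, hr1, mul_one, hκ1]
    rfl
  choose ρ hρ hρint using hρ
  refine ⟨ρ, hρ, fun φ M ε hφ hε hclose => ?_⟩
  have hstep : IsStep fun t => φ (lift (ρ (β t) t) (β t)) :=
    ((hβ.bind hρ).prodMk hβ).comp fun z => φ (lift z.1 z.2)
  have h1 : ∫ t in B, φ (lift (ρ (β t) t) (β t)) ∂lebesgue =
      ∑ l, ∑ y ∈ Q, (b y * κ l y) * ∑ x ∈ R, r l x * φ (lift x y) := by
    rw [hβ.setIntegral_eq_sum hQ hB hstep, Finset.sum_comm]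
    refine Finset.sum_congr rfl fun y _ => ?_
    rw [setIntegral_congr_fun (g := fun t => φ (lift (ρ y t) y))
      (hB.inter (hβ.measurableSet_preimage {y}))
      (fun t ht => by simp only [mem_singleton_iff.1 ht.2]), hρint y fun x => φ (lift x y)]
    simp only [Finset.mul_sum, Finset.sum_mul]
    rw [Finset.sum_comm]
    exact Finset.sum_congr rfl fun l _ => Finset.sum_congr rfl fun x _ => by ring
  have h2 : ∫ t in B, φ (α t) ∂lebesgue = ∑ l, ∑ x ∈ R, a x * κ l (f x) * φ x := by
    rw [hαint, Finset.sum_comm]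
    refine Finset.sum_congr rfl fun x _ => ?_
    rw [← Finset.sum_mul, ← Finset.mul_sum, hκ1, mul_one]
  -- The masses `∫ κ l ∘ β` add up to that of `B`, so the `ε`-errors of all `l` together cost only
  -- `ε * lebesgue.real B`.
  have h3 : lebesgue.real B = ∑ l, ∫ t in B, κ l (β t) ∂lebesgue := by
    rw [← integral_finsetSum _ fun l _ => (hβ.comp (κ l)).integrable.integrableOn]
    simp [hκ1]
  rw [h1, h2, ← Finset.sum_sub_distrib, h3, Finset.mul_sum, Finset.mul_sum,
    ← Finset.sum_add_distrib]
  refine (Finset.abs_sum_le_sum_abs _ _).trans (Finset.sum_le_sum fun l _ => ?_)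
  refine abs_sum_sub_sum_le R Q (hr l) (hr1 l) (u := fun x => κ l (f x)) ?_
    (fun y _ => mul_nonneg (hb y) (hκ l y)) (hβint _).symm (fun x _ => hκ l _) hε hφ
    (fun x y => hφ _) ?_
  · intro x hx
    rw [hαint fun x => κ l (f x)]
    exact hrp l x hx
  · exact fun x _ y _ hx hy => hclose x y l hx (pos_of_mul_pos_right hy (hb y))

/-! ### Controlled lifts along an open map -/

/-- A fine enough partition of unity on the target of an open map admits controlled lifts. -/
theorem exists_partition_lift {X Y E : Type*} [TopologicalSpace X] [CompactSpace X]
    [TopologicalSpace Y] [CompactSpace Y] [T2Space Y] [PseudoMetricSpace E] {f : X → Y}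
    (hfc : Continuous f) (hf : Function.Surjective f) (hfo : IsOpenMap f) {g : X → E}
    (hg : Continuous g) {ε : ℝ} (hε : 0 < ε) :
    ∃ (L : Finset Y) (κ : L → C(Y, ℝ)) (lift : X → Y → X), (∀ l y, 0 ≤ κ l y) ∧
      (∀ y, ∑ l, κ l y = 1) ∧ (∀ x y, f (lift x y) = y) ∧
      ∀ x y l, 0 < κ l (f x) → 0 < κ l y → dist (g (lift x y)) (g x) ≤ ε := by
  classical
  have hloc : ∀ y : Y, ∃ N : Set Y, IsOpen N ∧ y ∈ N ∧
      ∀ x, f x ∈ N → ∀ z ∈ N, ∃ x', f x' = z ∧ dist (g x') (g x) ≤ ε := by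
    intro y
    have hG : ∀ x₀ : X, IsOpen (g ⁻¹' Metric.ball (g x₀) (ε / 2)) :=
      fun x₀ => Metric.isOpen_ball.preimage hg
    have hfib : IsCompact (f ⁻¹' {y}) := (isClosed_singleton.preimage hfc).isCompact
    obtain ⟨s, hs, hcov⟩ := hfib.elim_nhds_subcover
      (fun x₀ => g ⁻¹' Metric.ball (g x₀) (ε / 2)) fun x₀ _ =>
        (hG x₀).mem_nhds (Metric.mem_ball_self (by positivity))
    set W := ⋃ x₀ ∈ s, g ⁻¹' Metric.ball (g x₀) (ε / 2) with hW
    have hWo : IsOpen W := isOpen_biUnion fun x₀ _ => hG x₀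
    -- Over this neighbourhood every fibre lies in the union of the chosen small sets and meets each
    -- of them; openness of `f` makes the second condition open.
    refine ⟨(f '' Wᶜ)ᶜ ∩ ⋂ x₀ ∈ s, f '' (g ⁻¹' Metric.ball (g x₀) (ε / 2)), ?_, ⟨?_, ?_⟩, ?_⟩
    · refine (hWo.isClosed_compl.isCompact.image hfc).isClosed.isOpen_compl.inter ?_
      exact isOpen_biInter_finset fun x₀ _ => hfo _ (hG x₀)
    · rintro ⟨x, hx, rfl⟩
      exact hx (hcov rfl)
    · exact mem_iInter₂.2 fun x₀ hx₀ => ⟨x₀, Metric.mem_ball_self (by positivity), hs x₀ hx₀⟩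
    · intro x hx z hz
      have hxW : x ∈ W := by
        by_contra h
        exact hx.1 ⟨x, h, rfl⟩
      obtain ⟨x₀, hx₀, hxx₀⟩ := mem_iUnion₂.1 hxW
      obtain ⟨x', hx', rfl⟩ := mem_iInter₂.1 hz.2 x₀ hx₀
      refine ⟨x', rfl, (dist_triangle_right _ _ (g x₀)).trans ?_⟩
      have h1 : dist (g x') (g x₀) < ε / 2 := hx'
      have h2 : dist (g x) (g x₀) < ε / 2 := hxx₀
      linarith
  choose N hNo hyN hN using hloc
  obtain ⟨L, -, hL⟩ := isCompact_univ.elim_nhds_subcover N fun y _ => (hNo y).mem_nhds (hyN y)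
  obtain ⟨κ, hκ⟩ := PartitionOfUnity.exists_isSubordinate isClosed_univ
    (fun l : L => N l) (fun l => hNo l) (by simpa [iUnion_subtype] using hL)
  have hpos : ∀ l y, 0 < κ l y → y ∈ N l := fun l y h => hκ l (subset_tsupport _ h.ne')
  have hlift : ∀ x y, ∃ x', f x' = y ∧
      ∀ l, 0 < κ l (f x) → 0 < κ l y → dist (g x') (g x) ≤ ε := by
    intro x y
    -- One common index suffices, since the estimate does not mention `l`; this keeps `lift`
    -- independent of `l`.
    by_cases h : ∃ l, 0 < κ l (f x) ∧ 0 < κ l y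
    · obtain ⟨l, h1, h2⟩ := h
      obtain ⟨x', hx', hd⟩ := hN l x (hpos l _ h1) y (hpos l _ h2)
      exact ⟨x', hx', fun _ _ _ => hd⟩
    · obtain ⟨x', hx'⟩ := hf y
      exact ⟨x', hx', fun l h1 h2 => (h ⟨l, h1, h2⟩).elim⟩
  choose lift hl1 hl2 using hlift
  refine ⟨L, κ, lift, fun l y => κ.nonneg l y, fun y => ?_, hl1, hl2⟩
  rw [← finsum_eq_sum_of_fintype, κ.sum_eq_one (mem_univ y)]

/-! ### From cells to averages -/

/-- The cells of a finite set containing both endpoints are intervals. -/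
theorem setOf_cell_eq {T : Finset ℝ} (h0 : 0 ∈ T) (h1 : 1 ∈ T) (t : Ico (0 : ℝ) 1) :
    ∃ u ∈ T, ∃ v ∈ T, u < v ∧
      {s | cell T s = cell T t} = {s : Ico (0 : ℝ) 1 | (s : ℝ) ∈ Ico u v} := by
  classical
  have hne : (cell T t).Nonempty := ⟨0, mem_cell.2 ⟨h0, t.2.1⟩⟩
  have hne' : (T \ cell T t).Nonempty :=
    ⟨1, Finset.mem_sdiff.2 ⟨h1, fun h => absurd (mem_cell.1 h).2 (not_le.2 t.2.2)⟩⟩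
  obtain ⟨huT, hut⟩ := mem_cell.1 ((cell T t).max'_mem hne)
  obtain ⟨hvT, hvt⟩ := Finset.mem_sdiff.1 ((T \ cell T t).min'_mem hne')
  have hvt' : (t : ℝ) < (T \ cell T t).min' hne' :=
    not_le.1 fun h => hvt (mem_cell.2 ⟨hvT, h⟩)
  refine ⟨_, huT, _, hvT, hut.trans_lt hvt', ?_⟩
  ext s
  simp only [mem_ofPred_eq, cell_eq_cell_iff, mem_Ico]
  constructor
  · exact fun h => ⟨(h _ huT).2 hut, not_le.1 fun h' => absurd ((h _ hvT).1 h') (not_le.2 hvt')⟩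
  · intro h c hc
    constructor
    · intro hcs
      by_contra hct
      exact absurd ((Finset.min'_le _ c (Finset.mem_sdiff.2
        ⟨hc, fun h' => hct (mem_cell.1 h').2⟩)).trans hcs) (not_le.2 h.2)
    · exact fun hct => ((cell T t).le_max' c (mem_cell.2 ⟨hc, hct⟩)).trans h.1

/-- A nonempty cell is an interval of length at most 1, so its integrals differ by no more than its
averages. -/
theorem abs_setIntegral_cell_sub_le {Y : Type*} [TopologicalSpace Y] {T : Finset ℝ} (h0 : 0 ∈ T)
    (h1 : 1 ∈ T) (hT : ∀ c ∈ T, c ∈ Icc (0 : ℝ) 1) {κ : C(Y, ℝ)} {β γ : HM Y} {δ : ℝ} (hδ : 0 ≤ δ)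
    (h : ∀ u ∈ T, ∀ v ∈ T, u < v → |HM.avg κ u v γ - HM.avg κ u v β| < δ) (S : Finset ℝ) :
    |∫ t in {t | cell T t = S}, κ (β.1 t) ∂lebesgue -
      ∫ t in {t | cell T t = S}, κ (γ.1 t) ∂lebesgue| ≤ δ := by
  by_cases hS : ∃ t, cell T t = S
  · obtain ⟨t, rfl⟩ := hS
    obtain ⟨u, hu, v, hv, huv, heq⟩ := setOf_cell_eq h0 h1 t
    have := h u hu v hv huv
    have hpos : 0 < v - u := sub_pos.2 huv
    rw [HM.avg_eq, HM.avg_eq, ← mul_sub, abs_mul, abs_inv, abs_of_pos hpos,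
      inv_mul_lt_iff₀ hpos, abs_sub_comm] at this
    rw [heq]
    refine this.le.trans (mul_le_of_le_one_left hδ ?_)
    linarith [(hT u hu).1, (hT v hv).2]
  · rw [show {t | cell T t = S} = ∅ from eq_empty_of_forall_notMem fun t ht => hS ⟨t, ht⟩]
    simpa using hδ

theorem abs_avg_sub_le {X : Type*} [TopologicalSpace X] {T : Finset ℝ} {a b : ℝ} (ha : a ∈ T)
    (hb : b ∈ T) (ha0 : 0 ≤ a) (hab : a < b) (hb1 : b ≤ 1) {φ : C(X, ℝ)} {α α' : HM X} {ε c : ℝ}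
    (hc : 0 ≤ c) (h : ∀ S, |∫ t in {t | cell T t = S}, φ (α'.1 t) ∂lebesgue -
      ∫ t in {t | cell T t = S}, φ (α.1 t) ∂lebesgue| ≤
        ε * lebesgue.real {t | cell T t = S} + c) :
    |HM.avg φ a b α' - HM.avg φ a b α| ≤ ε + (b - a)⁻¹ * (T.powerset.card * c) := by
  have hpos : 0 < b - a := sub_pos.2 hab
  have hR : ∀ t, cell T t ∈ T.powerset :=
    fun t => Finset.mem_powerset.2 fun c hc => (mem_cell.1 hc).1
  have hsplit : ∀ {g : Ico (0 : ℝ) 1 → ℝ}, IsStep g →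
      ∫ t in {t | (t : ℝ) ∈ Ico a b}, g t ∂lebesgue = ∑ S ∈ T.powerset,
        ∫ t in {t | (t : ℝ) ∈ Ico a b} ∩ cell T ⁻¹' {S}, g t ∂lebesgue := fun hg =>
    (isStep_cell T).setIntegral_eq_sum hR (measurableSet_val_Ico a b) hg
  have hlen : b - a = ∑ S ∈ T.powerset,
      lebesgue.real ({t | (t : ℝ) ∈ Ico a b} ∩ cell T ⁻¹' {S}) := by
    rw [← lebesgue_real_Ico ha0 hab.le hb1]
    simpa using hsplit (IsStep.const (1 : ℝ))
  have hcell : ∀ S, |∫ t in {t | (t : ℝ) ∈ Ico a b} ∩ cell T ⁻¹' {S}, φ (α'.1 t) ∂lebesgue -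
      ∫ t in {t | (t : ℝ) ∈ Ico a b} ∩ cell T ⁻¹' {S}, φ (α.1 t) ∂lebesgue| ≤
        ε * lebesgue.real ({t | (t : ℝ) ∈ Ico a b} ∩ cell T ⁻¹' {S}) + c := by
    intro S
    -- As `a` and `b` are cut points, a cell is either contained in `[a,b)` or disjoint from it.
    by_cases hS : a ∈ S ∧ b ∉ S
    · rw [inter_eq_right.2]
      · exact h S
      · rintro t rfl
        exact ⟨(mem_cell.1 hS.1).2, not_le.1 fun h' => hS.2 (mem_cell.2 ⟨hb, h'⟩)⟩
    · rw [show {t : Ico (0 : ℝ) 1 | (t : ℝ) ∈ Ico a b} ∩ cell T ⁻¹' {S} = ∅ from ?_]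
      · simpa using hc
      · refine eq_empty_of_forall_notMem ?_
        rintro t ⟨ht, rfl⟩
        exact hS ⟨mem_cell.2 ⟨ha, ht.1⟩, fun h' => absurd (mem_cell.1 h').2 (not_le.2 ht.2)⟩
  rw [HM.avg_eq, HM.avg_eq, ← mul_sub, abs_mul, abs_inv, abs_of_pos hpos,
    hsplit (α'.2.comp φ), hsplit (α.2.comp φ), ← Finset.sum_sub_distrib, inv_mul_le_iff₀ hpos,
    mul_add, mul_inv_cancel_left₀ hpos.ne']
  refine (Finset.abs_sum_le_sum_abs _ _).trans ((Finset.sum_le_sum fun S _ => hcell S).trans_eq ?_)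
  rw [Finset.sum_add_distrib, ← Finset.mul_sum, ← hlen, Finset.sum_const, nsmul_eq_mul, mul_comm ε]

/-- Composition with an open surjection is a uniformly open map of the spaces of step maps. -/
theorem HM.exists_lift_of_isOpenMap {X Y : Type*} [TopologicalSpace X] [CompactSpace X]
    [TopologicalSpace Y] [CompactSpace Y] [T2Space Y] (f : C(X, Y)) (hf : Function.Surjective f)
    (hfo : IsOpenMap f) {U : Set (HM X × HM X)} (hU : U ∈ 𝓤 (HM X)) :
    ∃ V ∈ 𝓤 (HM Y), ∀ α β, (HM.map f α, β) ∈ V → ∃ α', (α, α') ∈ U ∧ HM.map f α' = β := by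
  classical
  obtain ⟨s, ε, hε, hsU⟩ := HM.exists_finset_of_mem_uniformity hU
  choose φ a b ha hab hb hg using fun g : SHM X => g.2
  set T : Finset ℝ := insert 0 (insert 1 (s.image a ∪ s.image b)) with hTdef
  have haT : ∀ g ∈ s, a g ∈ T := fun g hg => by
    simp only [hTdef, Finset.mem_insert, Finset.mem_union]
    exact Or.inr (Or.inr (Or.inl (Finset.mem_image_of_mem a hg)))
  have hbT : ∀ g ∈ s, b g ∈ T := fun g hg => by
    simp only [hTdef, Finset.mem_insert, Finset.mem_union]
    exact Or.inr (Or.inr (Or.inr (Finset.mem_image_of_mem b hg)))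
  have h0 : (0 : ℝ) ∈ T := by simp [hTdef]
  have h1 : (1 : ℝ) ∈ T := by simp [hTdef]
  have hT : ∀ c ∈ T, c ∈ Icc (0 : ℝ) 1 := by
    intro c hc
    simp only [hTdef, Finset.mem_insert, Finset.mem_union, Finset.mem_image] at hc
    rcases hc with rfl | rfl | ⟨g, -, rfl⟩ | ⟨g, -, rfl⟩
    · simp
    · simp
    · exact ⟨ha g, (hab g).le.trans (hb g)⟩
    · exact ⟨(ha g).trans (hab g).le, hb g⟩
  -- All test functions are controlled at once through the sup metric on `s → ℝ`.
  obtain ⟨L, κ, lift, hκ, hκ1, hlift, hclose⟩ := exists_partition_lift f.continuous hf hfo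
    (g := fun x (g : s) => φ g x) (continuous_pi fun g => (φ g).continuous) (half_pos hε)
  set M : ℝ := ∑ g ∈ s, ‖φ g‖ with hMdef
  have hM0 : 0 ≤ M := Finset.sum_nonneg fun g _ => norm_nonneg _
  have hM : ∀ g ∈ s, ∀ x, |φ g x| ≤ M := fun g hgs x =>
    ((φ g).norm_coe_le_norm x).trans
      (Finset.single_le_sum (f := fun g => ‖φ g‖) (fun g _ => norm_nonneg _) hgs)
  obtain ⟨δ, hδ, hδ0⟩ : ∃ δ : ℝ, (∀ g ∈ s,
      (b g - a g)⁻¹ * (T.powerset.card * (3 * M * (L.card * δ))) < ε / 2) ∧ 0 < δ := by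
    have : ∀ᶠ δ in 𝓝[>] (0 : ℝ), ∀ g ∈ s,
        (b g - a g)⁻¹ * (T.powerset.card * (3 * M * (L.card * δ))) < ε / 2 := by
      refine (eventually_all_finset s).2 fun g _ => nhdsWithin_le_nhds ?_
      refine ContinuousAt.eventually_lt (by fun_prop) continuousAt_const ?_
      simpa using hε
    exact (this.and self_mem_nhdsWithin).exists
  refine ⟨{p | ∀ l : L, ∀ u ∈ T, ∀ v ∈ T, u < v →
    |HM.avg (κ l) u v p.1 - HM.avg (κ l) u v p.2| < δ}, ?_, fun α β hαβ => ?_⟩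
  · change ∀ᶠ p in 𝓤 (HM Y), ∀ l : L, ∀ u ∈ T, ∀ v ∈ T, u < v →
      |HM.avg (κ l) u v p.1 - HM.avg (κ l) u v p.2| < δ
    refine eventually_all.2 fun l => (eventually_all_finset T).2 fun u hu =>
      (eventually_all_finset T).2 fun v hv => ?_
    by_cases huv : u < v
    · have := HM.uniformContinuous_of_mem_SHM ⟨κ l, u, v, (hT u hu).1, huv, (hT v hv).2, rfl⟩
      filter_upwards [this (Metric.dist_mem_uniformity hδ0)] with p hp _
      exact hp
    · exact Eventually.of_forall fun p h => absurd h huv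
  choose ρ hρ hρint using fun S => exists_lift_on_block (f := f) (κ := fun l => κ l) hκ hκ1 lift
    α.2 β.2 (measurableSet_cell T S)
  -- The block lifts are glued along both the cell and the value of `β`.
  set α' : HM X := ⟨fun t => lift (ρ (cell T t) (β.1 t) t) (β.1 t),
    ((((isStep_cell T).prodMk β.2).bind (γ := fun z => ρ z.1 z.2) fun z => hρ z.1 z.2).prodMk
      β.2).comp fun z => lift z.1 z.2⟩ with hα'
  refine ⟨α', hsU α α' fun g hgs => ?_, Subtype.ext (funext fun t => hlift _ _)⟩
  rw [hg g, abs_sub_comm]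
  have hbound : ∀ S, |∫ t in {t | cell T t = S}, φ g (α'.1 t) ∂lebesgue -
      ∫ t in {t | cell T t = S}, φ g (α.1 t) ∂lebesgue| ≤
        ε / 2 * lebesgue.real {t | cell T t = S} + 3 * M * (L.card * δ) := by
    intro S
    rw [setIntegral_congr_fun (g := fun t => φ g (lift (ρ S (β.1 t) t) (β.1 t)))
      (measurableSet_cell T S) fun t ht => by simp only [hα', show cell T t = S from ht]]
    refine (hρint S (φ g) M (ε / 2) (hM g hgs) (half_pos hε).le fun x y l hx hy => ?_).trans ?_
    · exact (dist_le_pi_dist _ _ (⟨g, hgs⟩ : s)).trans (hclose x y l hx hy)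
    · gcongr
      refine (Finset.sum_le_sum fun l _ =>
        abs_setIntegral_cell_sub_le (κ := κ l) h0 h1 hT hδ0.le (hαβ l) S).trans_eq ?_
      simp
  have := abs_avg_sub_le (haT g hgs) (hbT g hgs) (ha g) (hab g) (hb g)
    (mul_nonneg (by positivity) (by positivity)) hbound
  linarith [hδ g hgs]

/-! ### The converse: openness of `f` from openness of `H.map f` -/

/-- The constant step maps. -/
def HM.const {X : Type*} (x : X) : HM X := ⟨fun _ => x, IsStep.const x⟩

theorem HM.avg_const {X : Type*} [TopologicalSpace X] (φ : C(X, ℝ)) (x : X) :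
    HM.avg φ 0 1 (HM.const x) = φ x := by
  rw [HM.avg_eq]
  simp [HM.const]

theorem HM.avg_mono {X : Type*} [TopologicalSpace X] {φ ψ : C(X, ℝ)} (h : ∀ x, φ x ≤ ψ x)
    (α : HM X) : HM.avg φ 0 1 α ≤ HM.avg ψ 0 1 α := by
  rw [HM.avg_eq, HM.avg_eq]
  refine mul_le_mul_of_nonneg_left ?_ (by norm_num)
  exact setIntegral_mono (α.2.comp φ).integrable.integrableOn
    (α.2.comp ψ).integrable.integrableOn fun t => h _

theorem HM.uniformContinuous_avg {X : Type*} [TopologicalSpace X] (φ : C(X, ℝ)) :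
    UniformContinuous (HM.avg φ 0 1) :=
  HM.uniformContinuous_of_mem_SHM ⟨φ, 0, 1, le_rfl, one_pos, le_rfl, rfl⟩

theorem HM.continuous_const {X : Type*} [TopologicalSpace X] :
    Continuous (HM.const : X → HM X) := by
  refine continuous_iff_continuousAt.2 fun x => ?_
  rw [ContinuousAt, nhds_eq_comap_uniformity, HM.uniformity_eq, tendsto_comap_iff, tendsto_iInf]
  rintro ⟨_, φ, a, b, ha, hab, hb, rfl⟩
  rw [tendsto_comap_iff]
  have hc : ∀ x, HM.avg φ a b (HM.const x) = φ x := fun x => by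
    rw [HM.avg_eq]
    simp only [HM.const, setIntegral_const, lebesgue_real_Ico ha hab.le hb, smul_eq_mul]
    exact inv_mul_cancel_left₀ (sub_pos.2 hab).ne' _
  simp only [Function.comp_def, hc]
  exact Uniform.tendsto_nhds_right.1 φ.continuous.continuousAt

/-- The function `φ_(0,1)` on the completion. -/
noncomputable def H.avg {X : Type*} [TopologicalSpace X] (φ : C(X, ℝ)) : H X → ℝ :=
  UniformSpace.Completion.extension (HM.avg φ 0 1)

theorem H.continuous_avg {X : Type*} [TopologicalSpace X] (φ : C(X, ℝ)) :
    Continuous (H.avg φ) := UniformSpace.Completion.continuous_extension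

theorem H.avg_coe {X : Type*} [TopologicalSpace X] (φ : C(X, ℝ)) (α : HM X) :
    H.avg φ (α : H X) = HM.avg φ 0 1 α :=
  UniformSpace.Completion.extension_coe (HM.uniformContinuous_avg φ) α

theorem H.avg_mono {X : Type*} [TopologicalSpace X] {φ ψ : C(X, ℝ)} (h : ∀ x, φ x ≤ ψ x)
    (ξ : H X) : H.avg φ ξ ≤ H.avg ψ ξ := by
  induction ξ using UniformSpace.Completion.induction_on with
  | hp => exact isClosed_le (H.continuous_avg φ) (H.continuous_avg ψ)
  | ih α => simpa only [H.avg_coe] using HM.avg_mono h α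

theorem H.avg_half_add_comp {X Y : Type*} [TopologicalSpace X] [TopologicalSpace Y] (f : C(X, Y))
    (ψ : C(Y, ℝ)) (ξ : H X) :
    H.avg (ContinuousMap.const X (1 / 2) + ψ.comp f) ξ = 1 / 2 + H.avg ψ (H.map f ξ) := by
  induction ξ using UniformSpace.Completion.induction_on with
  | hp =>
    exact isClosed_eq (H.continuous_avg _)
      (continuous_const.add ((H.continuous_avg ψ).comp (H.map f).continuous))
  | ih α =>
    rw [H.map_coe, H.avg_coe, H.avg_coe, HM.avg_eq, HM.avg_eq]
    simp only [ContinuousMap.add_apply, ContinuousMap.const_apply, ContinuousMap.comp_apply]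
    rw [integral_add (integrable_const _) ((α.2.comp fun x => ψ (f x)).integrable.integrableOn)]
    rw [setIntegral_const, lebesgue_real_Ico le_rfl zero_le_one le_rfl]
    simp [HM.map]

theorem isOpenMap_of_isOpenMap_H_map {X Y : Type*} [TopologicalSpace X] [CompactSpace X] [T2Space X]
    [TopologicalSpace Y] [CompactSpace Y] [T2Space Y] (f : C(X, Y))
    (h : IsOpenMap (H.map f)) : IsOpenMap f := by
  rw [isOpenMap_iff_nhds_le]
  intro x₀ O hO
  obtain ⟨W, hWO, hW, hxW⟩ := mem_nhds_iff.1 (mem_map.1 hO)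
  obtain ⟨φ, hφ0, hφ1, hφ⟩ := exists_continuous_zero_one_of_isClosed hW.isClosed_compl
    (isClosed_singleton (x := x₀)) (by simpa using hxW)
  have hopen : IsOpen (H.map f '' {ξ | 1 / 2 < H.avg φ ξ}) :=
    h _ (isOpen_lt continuous_const (H.continuous_avg φ))
  have hcont : Continuous fun y : Y => ((HM.const y : HM Y) : H Y) :=
    (UniformSpace.Completion.continuous_coe _).comp HM.continuous_const
  have hmem : f x₀ ∈ (fun y : Y => ((HM.const y : HM Y) : H Y)) ⁻¹'
      (H.map f '' {ξ | 1 / 2 < H.avg φ ξ}) := by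
    refine ⟨(HM.const x₀ : HM X), ?_, H.map_coe f _⟩
    rw [mem_ofPred_eq, H.avg_coe, HM.avg_const, hφ1 rfl]
    norm_num
  refine mem_of_superset ((hopen.preimage hcont).mem_nhds hmem) ?_
  rintro y ⟨ξ, hξ, hξy⟩
  by_contra hy
  have hK : IsClosed (f '' {x | 1 / 2 ≤ φ x}) :=
    ((isClosed_le continuous_const φ.continuous).isCompact.image f.continuous).isClosed
  have hyK : y ∉ f '' {x | 1 / 2 ≤ φ x} := by
    rintro ⟨x, hx, rfl⟩
    refine hy (hWO ?_)
    by_contra hxW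
    have hx' : 1 / 2 ≤ φ x := hx
    rw [hφ0 hxW] at hx'
    norm_num at hx'
  obtain ⟨ψ, hψ0, hψ1, hψ⟩ := exists_continuous_zero_one_of_isClosed
    (isClosed_singleton (x := y)) hK (by simpa using hyK)
  -- This pointwise bound forces the average of `φ` at `ξ` to be at most `1 / 2 + ψ y = 1 / 2`,
  -- against the choice of `ξ`.
  have hle : ∀ x, φ x ≤ (ContinuousMap.const X (1 / 2) + ψ.comp f : C(X, ℝ)) x := by
    intro x
    simp only [ContinuousMap.add_apply, ContinuousMap.const_apply, ContinuousMap.comp_apply]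
    rcases le_or_gt (1 / 2) (φ x) with hx | hx
    · rw [hψ1 ⟨x, hx, rfl⟩]
      have := (hφ x).2
      simp only [Pi.one_apply]
      linarith
    · linarith [(hψ (f x)).1]
  have := H.avg_mono hle ξ
  rw [H.avg_half_add_comp, hξy, H.avg_coe, HM.avg_const, hψ0 rfl] at this
  have hξ' : 1 / 2 < H.avg φ ξ := hξ
  rw [Pi.zero_apply] at this
  linarith

end HartmanMycielski

theorem theorem1p1 {X Y : Type*} [TopologicalSpace X] [CompactSpace X] [T2Space X]
    [TopologicalSpace Y] [CompactSpace Y] [T2Space Y] (f : C(X, Y))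
    (hf : Function.Surjective f) :
    IsOpenMap (HartmanMycielski.H.map f) ↔ IsOpenMap f :=
  ⟨HartmanMycielski.isOpenMap_of_isOpenMap_H_map f, fun h =>
    HartmanMycielski.isOpenMap_completionMap (HartmanMycielski.HM.totallyBounded_univ X)
      (HartmanMycielski.HM.uniformContinuous_map f)
      fun _ hU => HartmanMycielski.HM.exists_lift_of_isOpenMap f hf h hU⟩
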